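/- For a set $P$ of positions of a $3\times 3$ matrix (a pattern) and $x=(x_p)_{p\in P}\in\mathbb{C}^{P}$, let $\mathrm{L}_P(x)$ be the $3\times3$ matrix with entry $x_p$ at each position $p\in P$ and $0$ at all other positions. For a $3\times 3$ matrix $\mathrm{L}$ and $1\le i<j<k\le 6$, let $\mathrm{L}^6_{ijk}$ be the $6\times 6$ matrix which carries $\mathrm{L}$ in rows and columns $i,j,k$ and coincides with the identity matrix elsewhere. Call a (partially defined) map $S:(x,y,z,t)\mapsto(u,v,w,r)$ from $(\mathbb{C}^{P})^4$ to itself *generated by* $P$ if its domain is Zariski dense in $(\mathbb{C}^P)^4$ (that is, no nonzero polynomial vanishes on it) and, for every $(x,y,z,t)$ in the domain, the local Zamolodchikov tetrahedron equation $$\mathrm{L}^6_{123}(u)\,\mathrm{L}^6_{145}(v)\,\mathrm{L}^6_{246}(w)\,\mathrm{L}^6_{356}(r)=\mathrm{L}^6_{356}(t)\,\mathrm{L}^6_{246}(z)\,\mathrm{L}^6_{145}(y)\,\mathrm{L}^6_{123}(x),\qquad \mathrm{L}=\mathrm{L}_P,$$ holds; the dimension of such a map is $\dim_{\mathbb{C}}(\mathbb{C}^P)^4=4|P|$.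 **Corollary 3.2 (maximum dimension).** The maximum of the dimensions of the maps generated by patterns $P$ is $20$. It is attained by the patterns $$\mathrm{A}=\begin{pmatrix} *&*&0\\ *&*&0\\ 0&0&* \end{pmatrix},\qquad \mathrm{B}=\begin{pmatrix} *&*&0\\ *&*&*\\ 0&0&0 \end{pmatrix},$$ which have $5$ free entries each: each of them generates a rational map $\mathbb{C}^{20}\dashrightarrow\mathbb{C}^{20}$, defined wherever some nonzero polynomial (a common denominator of its components) does not vanish. -/

import Mathlib

/-- The four extensions of a `3 × 3` matrix to a `6 × 6` matrix: the entries of `M` are placed at the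
intersections of the rows and columns with the three displayed indices (counted from `1`), and the
remaining part is that of the identity matrix. -/
def ext123 (M : Matrix (Fin 3) (Fin 3) ℂ) : Matrix (Fin 6) (Fin 6) ℂ :=
  !![M 0 0, M 0 1, M 0 2, 0, 0, 0;
     M 1 0, M 1 1, M 1 2, 0, 0, 0;
     M 2 0, M 2 1, M 2 2, 0, 0, 0;
     0, 0, 0, 1, 0, 0;
     0, 0, 0, 0, 1, 0;
     0, 0, 0, 0, 0, 1]

def ext145 (M : Matrix (Fin 3) (Fin 3) ℂ) : Matrix (Fin 6) (Fin 6) ℂ :=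
  !![M 0 0, 0, 0, M 0 1, M 0 2, 0;
     0, 1, 0, 0, 0, 0;
     0, 0, 1, 0, 0, 0;
     M 1 0, 0, 0, M 1 1, M 1 2, 0;
     M 2 0, 0, 0, M 2 1, M 2 2, 0;
     0, 0, 0, 0, 0, 1]

def ext246 (M : Matrix (Fin 3) (Fin 3) ℂ) : Matrix (Fin 6) (Fin 6) ℂ :=
  !![1, 0, 0, 0, 0, 0;
     0, M 0 0, 0, M 0 1, 0, M 0 2;
     0, 0, 1, 0, 0, 0;
     0, M 1 0, 0, M 1 1, 0, M 1 2;
     0, 0, 0, 0, 1, 0;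
     0, M 2 0, 0, M 2 1, 0, M 2 2]

def ext356 (M : Matrix (Fin 3) (Fin 3) ℂ) : Matrix (Fin 6) (Fin 6) ℂ :=
  !![1, 0, 0, 0, 0, 0;
     0, 1, 0, 0, 0, 0;
     0, 0, M 0 0, 0, M 0 1, M 0 2;
     0, 0, 0, 1, 0, 0;
     0, 0, M 1 0, 0, M 1 1, M 1 2;
     0, 0, M 2 0, 0, M 2 1, M 2 2]

/-- A pattern is the set of positions of a `3 × 3` matrix that carry free variables; the entries at
all other positions are zero. -/
abbrev Pattern := Finset (Fin 3 × Fin 3)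

/-- The matrix of the pattern `P` whose free entries have the values `x`. The full pattern gives the
`3 × 3` matrix with nine free entries. -/
def patternMatrix (P : Pattern) (x : P → ℂ) : Matrix (Fin 3) (Fin 3) ℂ :=
  Matrix.of fun i j => if h : (i, j) ∈ P then x ⟨(i, j), h⟩ else 0

/-- The space on which the maps generated by the pattern `P` act: the values of the free entries of
four matrices of this pattern, in the order `(x, y, z, t)`, respectively `(u, v, w, r)`. -/
abbrev PhaseSpace (P : Pattern) := Fin 4 × P → ℂ

/-- The `k`-th of the four matrices encoded by a point of the phase space. -/
def factor (P : Pattern) (X : PhaseSpace P) (k : Fin 4) : Matrix (Fin 3) (Fin 3) ℂ :=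
  patternMatrix P fun p => X (k, p)

/-- The local Zamolodchikov tetrahedron equation
`L₁₂₃(u) L₁₄₅(v) L₂₄₆(w) L₃₅₆(r) = L₃₅₆(t) L₂₄₆(z) L₁₄₅(y) L₁₂₃(x)`
for `X = (x, y, z, t)` and `U = (u, v, w, r)`. -/
def LocalTetrahedron (P : Pattern) (X U : PhaseSpace P) : Prop :=
  ext123 (factor P U 0) * ext145 (factor P U 1) * ext246 (factor P U 2) * ext356 (factor P U 3) =
    ext356 (factor P X 3) * ext246 (factor P X 2) * ext145 (factor P X 1) * ext123 (factor P X 0)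

/-- Zariski density: no nonzero polynomial vanishes on all of `D`. Nonempty Zariski open sets and
nonempty Euclidean open sets are Zariski dense. -/
def ZariskiDense {σ : Type*} (D : Set (σ → ℂ)) : Prop :=
  ∀ f : MvPolynomial σ ℂ, (∀ X ∈ D, MvPolynomial.eval X f = 0) → f = 0

/-- The map `S`, with domain of definition `D`, is generated by the pattern `P`: the variables
`x, y, z, t` are free (the domain is Zariski dense), and `(u, v, w, r) = S (x, y, z, t)` solves the
local tetrahedron equation on the domain. The values of `S` off `D` are irrelevant. -/
def GeneratesMap (P : Pattern) (D : Set (PhaseSpace P)) (S : PhaseSpace P → PhaseSpace P) : Prop :=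
  ZariskiDense D ∧ ∀ X ∈ D, LocalTetrahedron P X (S X)

/-- The dimension of the maps generated by the pattern `P`: they are maps from `ℂⁿ` to `ℂⁿ`, where
`n` is the dimension of the phase space. -/
noncomputable def mapDim (P : Pattern) : ℕ := Module.finrank ℂ (PhaseSpace P)

/-- The pattern `A`, with rows `(* * 0)`, `(* * 0)`, `(0 0 *)`. -/
def patternA : Pattern := {(0, 0), (0, 1), (1, 0), (1, 1), (2, 2)}

/-- The pattern `B`, with rows `(* * 0)`, `(* * *)`, `(0 0 0)`. -/
def patternB : Pattern := {(0, 0), (0, 1), (1, 0), (1, 1), (1, 2)}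

/-- The pattern `P` generates a rational map: numerators `N i` over a common nonzero denominator `q`
whose quotients, wherever `q` does not vanish, solve the local tetrahedron equation. -/
def GeneratesRationalMap (P : Pattern) : Prop :=
  ∃ (q : MvPolynomial (Fin 4 × P) ℂ) (N : Fin 4 × P → MvPolynomial (Fin 4 × P) ℂ), q ≠ 0 ∧
    GeneratesMap P {X | MvPolynomial.eval X q ≠ 0}
      fun X i => MvPolynomial.eval X (N i) / MvPolynomial.eval X q

/-!
The equation `LHS(U) = RHS(X)` consists of `36` polynomial equations, one for each entry of a
`6 × 6` matrix; `ext_mul_left` and `ext_mul_right` list both sides for full `3 × 3` factors. The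
nine positions of a pattern are called `a b c / d e f / g h k`, row by row (hypotheses are named
accordingly), and entries of the `6 × 6` matrices are counted from `1` in the names of lemmas.

*Upper bound.* A pattern generates no map as soon as some nonzero polynomial in `X` vanishes at
every `X` for which the equation is solvable in `U`: a Zariski dense domain would force that
polynomial to be zero (`Obstructed.not_generatesMap`). Such polynomials come from the minors of the
right-hand side for which the corresponding minor of the left-hand side vanishes identically. The
entry `(6, 1)` of the left-hand side is always zero, which excludes every pattern containing `g`
(`obstructed_of_corner_mem`). If `g` is absent, then single entries, `2 × 2` minors of rank-one
blocks and two `3 × 3` minors of rank-two blocks of the left-hand side are enough to obstruct every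
pattern with at least six positions (`obstructed_of_six_le_card`).

*Existence.* If the pattern consists of the block `a b / d e` and of at most one of the positions
`f` and `k`, the equation separates: the entries which involve `f` or `k` are matched by products
of known quantities, and the `2 × 2` block reduces to completing a given column and a given row to a
decomposition of a `2 × 2` matrix into two rank-one matrices. This has an explicit solution whose
only denominator is the polynomial `solDenom` (`rank_one_completion`,
`generatesRationalMap_of_block`). Both patterns `A` and `B` are of this kind.
-/

/-! ### The two sides of the local tetrahedron equation -/

theorem ext_mul_left (u v w r : Matrix (Fin 3) (Fin 3) ℂ) :
    ext123 u * ext145 v * ext246 w * ext356 r =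
  !![u 0 0 * v 0 0,
    u 0 0 * v 0 1 * w 1 0 + u 0 1 * w 0 0,
    u 0 0 * v 0 1 * w 1 2 * r 2 0 + u 0 0 * v 0 2 * r 1 0 + u 0 1 * w 0 2 * r 2 0 + u 0 2 * r 0 0,
    u 0 0 * v 0 1 * w 1 1 + u 0 1 * w 0 1,
    u 0 0 * v 0 1 * w 1 2 * r 2 1 + u 0 0 * v 0 2 * r 1 1 + u 0 1 * w 0 2 * r 2 1 + u 0 2 * r 0 1,
    u 0 0 * v 0 1 * w 1 2 * r 2 2 + u 0 0 * v 0 2 * r 1 2 + u 0 1 * w 0 2 * r 2 2 + u 0 2 * r 0 2;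
    u 1 0 * v 0 0,
    u 1 0 * v 0 1 * w 1 0 + u 1 1 * w 0 0,
    u 1 0 * v 0 1 * w 1 2 * r 2 0 + u 1 0 * v 0 2 * r 1 0 + u 1 1 * w 0 2 * r 2 0 + u 1 2 * r 0 0,
    u 1 0 * v 0 1 * w 1 1 + u 1 1 * w 0 1,
    u 1 0 * v 0 1 * w 1 2 * r 2 1 + u 1 0 * v 0 2 * r 1 1 + u 1 1 * w 0 2 * r 2 1 + u 1 2 * r 0 1,
    u 1 0 * v 0 1 * w 1 2 * r 2 2 + u 1 0 * v 0 2 * r 1 2 + u 1 1 * w 0 2 * r 2 2 + u 1 2 * r 0 2;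
    u 2 0 * v 0 0,
    u 2 0 * v 0 1 * w 1 0 + u 2 1 * w 0 0,
    u 2 0 * v 0 1 * w 1 2 * r 2 0 + u 2 0 * v 0 2 * r 1 0 + u 2 1 * w 0 2 * r 2 0 + u 2 2 * r 0 0,
    u 2 0 * v 0 1 * w 1 1 + u 2 1 * w 0 1,
    u 2 0 * v 0 1 * w 1 2 * r 2 1 + u 2 0 * v 0 2 * r 1 1 + u 2 1 * w 0 2 * r 2 1 + u 2 2 * r 0 1,
    u 2 0 * v 0 1 * w 1 2 * r 2 2 + u 2 0 * v 0 2 * r 1 2 + u 2 1 * w 0 2 * r 2 2 + u 2 2 * r 0 2;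
    v 1 0,
    v 1 1 * w 1 0,
    v 1 1 * w 1 2 * r 2 0 + v 1 2 * r 1 0,
    v 1 1 * w 1 1,
    v 1 1 * w 1 2 * r 2 1 + v 1 2 * r 1 1,
    v 1 1 * w 1 2 * r 2 2 + v 1 2 * r 1 2;
    v 2 0,
    v 2 1 * w 1 0,
    v 2 1 * w 1 2 * r 2 0 + v 2 2 * r 1 0,
    v 2 1 * w 1 1,
    v 2 1 * w 1 2 * r 2 1 + v 2 2 * r 1 1,
    v 2 1 * w 1 2 * r 2 2 + v 2 2 * r 1 2;
    0,
    w 2 0,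
    w 2 2 * r 2 0,
    w 2 1,
    w 2 2 * r 2 1,
    w 2 2 * r 2 2] := by
  simp only [ext123, ext145, ext246, ext356]
  ext i j
  fin_cases i <;> simp <;> fin_cases j <;> simp <;> ring

theorem ext_mul_right (x y z t : Matrix (Fin 3) (Fin 3) ℂ) :
    ext356 t * ext246 z * ext145 y * ext123 x =
  !![y 0 0 * x 0 0,
    y 0 0 * x 0 1,
    y 0 0 * x 0 2,
    y 0 1,
    y 0 2,
    0;
    z 0 0 * x 1 0 + z 0 1 * y 1 0 * x 0 0,
    z 0 0 * x 1 1 + z 0 1 * y 1 0 * x 0 1,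
    z 0 0 * x 1 2 + z 0 1 * y 1 0 * x 0 2,
    z 0 1 * y 1 1,
    z 0 1 * y 1 2,
    z 0 2;
    t 0 0 * x 2 0 + t 0 1 * y 2 0 * x 0 0 + t 0 2 * z 2 0 * x 1 0 + t 0 2 * z 2 1 * y 1 0 * x 0 0,
    t 0 0 * x 2 1 + t 0 1 * y 2 0 * x 0 1 + t 0 2 * z 2 0 * x 1 1 + t 0 2 * z 2 1 * y 1 0 * x 0 1,
    t 0 0 * x 2 2 + t 0 1 * y 2 0 * x 0 2 + t 0 2 * z 2 0 * x 1 2 + t 0 2 * z 2 1 * y 1 0 * x 0 2,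
    t 0 1 * y 2 1 + t 0 2 * z 2 1 * y 1 1,
    t 0 1 * y 2 2 + t 0 2 * z 2 1 * y 1 2,
    t 0 2 * z 2 2;
    z 1 0 * x 1 0 + z 1 1 * y 1 0 * x 0 0,
    z 1 0 * x 1 1 + z 1 1 * y 1 0 * x 0 1,
    z 1 0 * x 1 2 + z 1 1 * y 1 0 * x 0 2,
    z 1 1 * y 1 1,
    z 1 1 * y 1 2,
    z 1 2;
    t 1 0 * x 2 0 + t 1 1 * y 2 0 * x 0 0 + t 1 2 * z 2 0 * x 1 0 + t 1 2 * z 2 1 * y 1 0 * x 0 0,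
    t 1 0 * x 2 1 + t 1 1 * y 2 0 * x 0 1 + t 1 2 * z 2 0 * x 1 1 + t 1 2 * z 2 1 * y 1 0 * x 0 1,
    t 1 0 * x 2 2 + t 1 1 * y 2 0 * x 0 2 + t 1 2 * z 2 0 * x 1 2 + t 1 2 * z 2 1 * y 1 0 * x 0 2,
    t 1 1 * y 2 1 + t 1 2 * z 2 1 * y 1 1,
    t 1 1 * y 2 2 + t 1 2 * z 2 1 * y 1 2,
    t 1 2 * z 2 2;
    t 2 0 * x 2 0 + t 2 1 * y 2 0 * x 0 0 + t 2 2 * z 2 0 * x 1 0 + t 2 2 * z 2 1 * y 1 0 * x 0 0,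
    t 2 0 * x 2 1 + t 2 1 * y 2 0 * x 0 1 + t 2 2 * z 2 0 * x 1 1 + t 2 2 * z 2 1 * y 1 0 * x 0 1,
    t 2 0 * x 2 2 + t 2 1 * y 2 0 * x 0 2 + t 2 2 * z 2 0 * x 1 2 + t 2 2 * z 2 1 * y 1 0 * x 0 2,
    t 2 1 * y 2 1 + t 2 2 * z 2 1 * y 1 1,
    t 2 1 * y 2 2 + t 2 2 * z 2 1 * y 1 2,
    t 2 2 * z 2 2] := by
  simp only [ext123, ext145, ext246, ext356]
  ext i j
  fin_cases i <;> simp <;> fin_cases j <;> simp <;> ring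

theorem LocalTetrahedron.entry {P : Pattern} {X U : PhaseSpace P} (h : LocalTetrahedron P X U)
    (i j : Fin 6) :
    (ext123 (factor P U 0) * ext145 (factor P U 1) * ext246 (factor P U 2) *
      ext356 (factor P U 3)) i j =
    (ext356 (factor P X 3) * ext246 (factor P X 2) * ext145 (factor P X 1) *
      ext123 (factor P X 0)) i j :=
  congrFun (congrFun h i) j

theorem factor_of_notMem {P : Pattern} (X : PhaseSpace P) (k : Fin 4) {i j : Fin 3}
    (h : (i, j) ∉ P) : factor P X k i j = 0 := by
  simp [factor, patternMatrix, h]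

/-! ### Polynomial obstructions to solvability -/

/-- The generic `k`-th factor: the matrix of the pattern `P` whose free entries are the coordinate
functions of the phase space. -/
noncomputable def coord (P : Pattern) (k : Fin 4) :
    Matrix (Fin 3) (Fin 3) (MvPolynomial (Fin 4 × P) ℂ) :=
  Matrix.of fun i j => if h : (i, j) ∈ P then MvPolynomial.X (k, ⟨(i, j), h⟩) else 0

@[simp]
theorem eval_coord (P : Pattern) (X : PhaseSpace P) (k : Fin 4) (i j : Fin 3) :
    MvPolynomial.eval X (coord P k i j) = factor P X k i j := by
  by_cases h : (i, j) ∈ P <;> simp [coord, factor, patternMatrix, h]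

/-- The point of the phase space whose factors have the entries of `L` at the positions of the
pattern; the remaining entries of `L` are ignored. -/
def point (P : Pattern) (L : Fin 4 → Fin 3 → Fin 3 → ℂ) : PhaseSpace P :=
  fun p => L p.1 p.2.1.1 p.2.1.2

theorem factor_point {P : Pattern} (L : Fin 4 → Fin 3 → Fin 3 → ℂ) (k : Fin 4)
    (i j : Fin 3) : factor P (point P L) k i j = if (i, j) ∈ P then L k i j else 0 := by
  by_cases h : (i, j) ∈ P <;> simp [point, factor, patternMatrix, h]

/-- Solvability of the local tetrahedron equation in `U` forces a nonzero polynomial to vanish at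
`X`. -/
def Obstructed (P : Pattern) : Prop :=
  ∃ f : MvPolynomial (Fin 4 × P) ℂ, f ≠ 0 ∧
    ∀ X U : PhaseSpace P, LocalTetrahedron P X U → MvPolynomial.eval X f = 0

theorem Obstructed.not_generatesMap {P : Pattern} (h : Obstructed P) (D : Set (PhaseSpace P))
    (S : PhaseSpace P → PhaseSpace P) : ¬ GeneratesMap P D S := by
  obtain ⟨f, hf, hU⟩ := h
  exact fun hS => hf (hS.1 f fun X hX => hU X (S X) (hS.2 X hX))

/-- That an obstruction is a nonzero polynomial is checked by evaluating it at one point. -/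
theorem Obstructed.of_point {P : Pattern} (f : MvPolynomial (Fin 4 × P) ℂ)
    (L : Fin 4 → Fin 3 → Fin 3 → ℂ) (hL : MvPolynomial.eval (point P L) f ≠ 0)
    (hf : ∀ X U : PhaseSpace P, LocalTetrahedron P X U → MvPolynomial.eval X f = 0) :
    Obstructed P :=
  ⟨f, fun h => hL (by simp [h]), hf⟩

/-! ### Obstructions from vanishing minors of the left-hand side -/

/-- The entry `(6, 1)` of the left-hand side is zero, while on the right-hand side it contains the
monomial given by two corner entries `g`. -/
theorem obstructed_of_corner_mem {P : Pattern} (g : (2, 0) ∈ P) : Obstructed P := by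
  refine .of_point (coord P 3 2 0 * coord P 0 2 0 + coord P 3 2 1 * coord P 1 2 0 *
    coord P 0 0 0 +
    coord P 3 2 2 * coord P 2 2 0 * coord P 0 1 0 +
    coord P 3 2 2 * coord P 2 2 1 * coord P 1 1 0 * coord P 0 0 0)
    (fun k _ _ => if k = 0 ∨ k = 3 then 1 else 0) ?_ fun X U h => ?_
  · simp [factor_point, g]
  · have := h.entry 5 0
    simp [ext_mul_left, ext_mul_right] at this
    simp
    linear_combination -this

/-- If `d` and `h` belong to the pattern, the first three entries of the last row and the first
entries of the third and fifth rows of the right-hand side contain the product of an entry of the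
third column, `h`, `d`, and an entry of the first row; the left-hand side vanishes there without
`g`. -/
theorem obstructed_of_path {P : Pattern} (hg : (2, 0) ∉ P) (hd : (1, 0) ∈ P) (hh : (2, 1) ∈ P)
    {i j : Fin 3} (hi : (i, 2) ∈ P) (hj : (0, j) ∈ P) (hij : i = 2 ∨ j = 0) : Obstructed P := by
  refine .of_point (coord P 3 i 2 * coord P 2 2 1 * coord P 1 1 0 * coord P 0 0 j)
    (fun _ _ _ => 1) ?_ fun X U h => ?_
  · simp [factor_point, hd, hh, hi, hj]
  · have e := h.entry (![2, 4, 5] i) (![0, 1, 2] j)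
    rcases hij with rfl | rfl
    · fin_cases j <;> simpa [ext_mul_left, ext_mul_right, factor_of_notMem _ _ hg] using e
    · fin_cases i <;> simpa [ext_mul_left, ext_mul_right, factor_of_notMem _ _ hg] using e

theorem obstructed_of_entry₃₂ {P : Pattern} (hg : (2, 0) ∉ P) (ha : (0, 0) ∉ P)
    (hb : (0, 1) ∈ P) (hc : (0, 2) ∈ P) (hd : (1, 0) ∈ P) (hh : (2, 1) ∈ P) : Obstructed P := by
  refine .of_point (coord P 3 0 2 * coord P 2 2 1 * coord P 1 1 0 * coord P 0 0 1)
    (fun _ _ _ => 1) ?_ fun X U H => ?_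
  · simp [factor_point, hb, hc, hd, hh]
  · simpa [ext_mul_left, ext_mul_right, factor_of_notMem _ _ hg, factor_of_notMem _ _ ha] using
    H.entry 2 1

/-- Without `g` and `h`, the block of the left-hand side in rows `4, 5` and columns `3, 5` is the
column `(f, k)` of `v` times the row `(d, e)` of `r`, so its determinant is zero. -/
theorem obstructed_of_minor₄₅_₃₅ {P : Pattern} (hg : (2, 0) ∉ P) (hh : (2, 1) ∉ P)
    (hd : (1, 0) ∈ P) (he : (1, 1) ∈ P) (hf : (1, 2) ∈ P) (hk : (2, 2) ∈ P) : Obstructed P := by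
  refine .of_point ((coord P 2 1 0 * coord P 0 1 2 + coord P 2 1 1 * coord P 1 1 0 *
    coord P 0 0 2) * (coord P 3 1 1 * coord P 1 2 2) - coord P 2 1 1 * coord P 1 1 2 *
    (coord P 3 1 0 * coord P 0 2 2))
    (fun k i j => if k = 2 ∧ (i, j) = (1, 1) then 0 else 1) ?_ fun X U H => ?_
  · simp [factor_point, hd, he, hf, hk]
  · have e43 := H.entry 3 2
    have e45 := H.entry 3 4
    have e53 := H.entry 4 2
    have e55 := H.entry 4 4
    simp [ext_mul_left, ext_mul_right, factor_of_notMem _ _ hg, factor_of_notMem _ _ hh]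
      at e43 e45 e53 e55
    simp only [map_sub, map_mul, map_add, eval_coord]
    simp only [← e43, ← e45, ← e53, ← e55]
    ring

theorem obstructed_of_entry₄₃ {P : Pattern} (hg : (2, 0) ∉ P) (hh : (2, 1) ∉ P) (hf : (1, 2) ∉ P)
    (hc : (0, 2) ∈ P) (hd : (1, 0) ∈ P) (he : (1, 1) ∈ P) : Obstructed P := by
  refine .of_point (coord P 2 1 1 * coord P 1 1 0 * coord P 0 0 2)
    (fun _ _ _ => 1) ?_ fun X U H => ?_
  · simp [factor_point, hc, hd, he]
  · simpa [ext_mul_left, ext_mul_right, factor_of_notMem _ _ hg, factor_of_notMem _ _ hh,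
    factor_of_notMem _ _ hf] using H.entry 3 2

/-- Without `e`, `g` and `h`, the block of the left-hand side in rows `4, 5` and columns `3, 6` is
the column `(f, k)` of `v` times the row `(d, f)` of `r`. -/
theorem obstructed_of_minor₄₅_₃₆ {P : Pattern} (hg : (2, 0) ∉ P) (hh : (2, 1) ∉ P)
    (he : (1, 1) ∉ P) (hd : (1, 0) ∈ P) (hf : (1, 2) ∈ P) (hk : (2, 2) ∈ P) : Obstructed P := by
  refine .of_point (coord P 2 1 0 * coord P 0 1 2 * (coord P 3 1 2 * coord P 2 2 2) -
    coord P 2 1 2 * (coord P 3 1 0 * coord P 0 2 2))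
    (fun k i j => if k = 0 ∧ (i, j) = (1, 2) then 2 else 1) ?_ fun X U H => ?_
  · simp [factor_point, hd, hf, hk]
    norm_num
  · have e43 := H.entry 3 2
    have e56 := H.entry 4 5
    have e46 := H.entry 3 5
    have e53 := H.entry 4 2
    simp [ext_mul_left, ext_mul_right, factor_of_notMem _ _ hg, factor_of_notMem _ _ hh,
      factor_of_notMem _ _ he] at e43 e56 e46 e53
    simp only [map_sub, map_mul, eval_coord]
    simp only [← e43, ← e56, ← e46, ← e53]
    ring

/-- Without `d`, `g` and `h`, the block of the left-hand side in rows `2, 3` and columns `3, 5` is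
the column `(f, k)` of `u` times the row `(a, b)` of `r`. -/
theorem obstructed_of_minor₂₃_₃₅ {P : Pattern} (hg : (2, 0) ∉ P) (hh : (2, 1) ∉ P)
    (hd : (1, 0) ∉ P) (ha : (0, 0) ∈ P) (hb : (0, 1) ∈ P) (hf : (1, 2) ∈ P) (hk : (2, 2) ∈ P) :
    Obstructed P := by
  refine .of_point (coord P 2 0 0 * coord P 0 1 2 * (coord P 3 0 1 * coord P 1 2 2) -
    coord P 2 0 1 * coord P 1 1 2 * (coord P 3 0 0 * coord P 0 2 2))
    (fun k i j => if k = 0 ∧ (i, j) = (1, 2) then 2 else 1) ?_ fun X U H => ?_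
  · simp [factor_point, ha, hb, hf, hk]
    norm_num
  · have e23 := H.entry 1 2
    have e25 := H.entry 1 4
    have e33 := H.entry 2 2
    have e35 := H.entry 2 4
    simp [ext_mul_left, ext_mul_right, factor_of_notMem _ _ hg, factor_of_notMem _ _ hh,
      factor_of_notMem _ _ hd] at e23 e25 e33 e35
    simp only [map_sub, map_mul, eval_coord]
    simp only [← e23, ← e25, ← e33, ← e35]
    ring

/-- Without `g`, `h` and `k`, the block of the left-hand side in rows `1, 2, 4` and columns
`3, 5, 6` factors through the first two rows of `r`, so it has rank at most two. -/
theorem obstructed_of_minor₁₂₄_₃₅₆ {P : Pattern} (hg : (2, 0) ∉ P) (hh : (2, 1) ∉ P)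
    (hk : (2, 2) ∉ P) (ha : (0, 0) ∈ P) (hb : (0, 1) ∈ P) (hc : (0, 2) ∈ P) (hd : (1, 0) ∈ P)
    (he : (1, 1) ∈ P) (hf : (1, 2) ∈ P) : Obstructed P := by
  -- the minor, expanded along its first row, whose last entry is zero
  refine .of_point (coord P 1 0 0 * coord P 0 0 2 *
    (coord P 2 0 1 * coord P 1 1 2 * coord P 2 1 2 - coord P 2 0 2 *
    (coord P 2 1 1 * coord P 1 1 2)) - coord P 1 0 2 *
    ((coord P 2 0 0 * coord P 0 1 2 + coord P 2 0 1 * coord P 1 1 0 * coord P 0 0 2) *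
    coord P 2 1 2 - coord P 2 0 2 * (coord P 2 1 0 * coord P 0 1 2 + coord P 2 1 1 *
    coord P 1 1 0 * coord P 0 0 2)))
    (fun k i j => if (k = 1 ∨ k = 2) ∧ (i, j) = (0, 2) then 0 else 1) ?_ fun X U H => ?_
  · simp [factor_point, ha, hb, hc, hd, he, hf]
  · have e13 := H.entry 0 2
    have e15 := H.entry 0 4
    have e16 := H.entry 0 5
    have e23 := H.entry 1 2
    have e25 := H.entry 1 4
    have e26 := H.entry 1 5
    have e43 := H.entry 3 2
    have e45 := H.entry 3 4
    have e46 := H.entry 3 5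
    simp [ext_mul_left, ext_mul_right, factor_of_notMem _ _ hg, factor_of_notMem _ _ hh,
      factor_of_notMem _ _ hk] at e13 e15 e16 e23 e25 e26 e43 e45 e46
    simp only [map_sub, map_mul, map_add, eval_coord]
    simp only [← e13, ← e15, ← e23, ← e25, ← e26, ← e43, ← e45, ← e46]
    -- the cofactor of the entry `(1, 6)`, which is zero on the right-hand side
    linear_combination -(factor P U 1 1 2 * factor P U 0 1 2 *
      (factor P U 3 0 0 * factor P U 3 1 1 - factor P U 3 0 1 * factor P U 3 1 0)) * e16

/-- Without `d` and `g`, the block of the left-hand side in rows `2, 3` and columns `2, 4` is the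
column `(e, h)` of `u` times the row `(a, b)` of `w`. -/
theorem obstructed_of_minor₂₃_₂₄ {P : Pattern} (hg : (2, 0) ∉ P) (hd : (1, 0) ∉ P)
    (ha : (0, 0) ∈ P) (hb : (0, 1) ∈ P) (he : (1, 1) ∈ P) (hh : (2, 1) ∈ P) : Obstructed P := by
  refine .of_point (coord P 2 0 0 * coord P 0 1 1 *
    (coord P 3 0 1 * coord P 1 2 1 + coord P 3 0 2 * coord P 2 2 1 * coord P 1 1 1) -
    coord P 2 0 1 * coord P 1 1 1 * (coord P 3 0 0 * coord P 0 2 1))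
    (fun k i j => if k = 2 ∧ i ≠ j then 0 else 1) ?_ fun X U H => ?_
  · simp [factor_point, ha, hb, he, hh]
  · have e22 := H.entry 1 1
    have e34 := H.entry 2 3
    have e24 := H.entry 1 3
    have e32 := H.entry 2 1
    simp [ext_mul_left, ext_mul_right, factor_of_notMem _ _ hg, factor_of_notMem _ _ hd]
      at e22 e34 e24 e32
    simp only [map_sub, map_mul, map_add, eval_coord]
    simp only [← e22, ← e34, ← e24, ← e32]
    ring

theorem obstructed_of_entry₃₄ {P : Pattern} (hg : (2, 0) ∉ P) (hd : (1, 0) ∉ P) (hb : (0, 1) ∉ P)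
    (hc : (0, 2) ∈ P) (he : (1, 1) ∈ P) (hh : (2, 1) ∈ P) : Obstructed P := by
  refine .of_point (coord P 3 0 2 * coord P 2 2 1 * coord P 1 1 1)
    (fun _ _ _ => 1) ?_ fun X U H => ?_
  · simp [factor_point, hc, he, hh]
  · simpa [ext_mul_left, ext_mul_right, factor_of_notMem _ _ hg, factor_of_notMem _ _ hd,
    factor_of_notMem _ _ hb] using H.entry 2 3

/-- Without `d`, `e` and `g`, the block of the left-hand side in rows `1, 3` and columns `2, 4` is
the column `(b, h)` of `u` times the row `(a, b)` of `w`. -/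
theorem obstructed_of_minor₁₃_₂₄ {P : Pattern} (hg : (2, 0) ∉ P) (hd : (1, 0) ∉ P)
    (he : (1, 1) ∉ P) (ha : (0, 0) ∈ P) (hb : (0, 1) ∈ P) (hh : (2, 1) ∈ P) : Obstructed P := by
  refine .of_point (coord P 1 0 0 * coord P 0 0 1 * (coord P 3 0 1 * coord P 1 2 1) -
    coord P 1 0 1 * (coord P 3 0 0 * coord P 0 2 1))
    (fun k i j => if k = 0 ∧ (i, j) = (0, 1) then 2 else 1) ?_ fun X U H => ?_
  · simp [factor_point, ha, hb, hh]
    norm_num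
  · have e12 := H.entry 0 1
    have e34 := H.entry 2 3
    have e14 := H.entry 0 3
    have e32 := H.entry 2 1
    simp [ext_mul_left, ext_mul_right, factor_of_notMem _ _ hg, factor_of_notMem _ _ hd,
      factor_of_notMem _ _ he] at e12 e34 e14 e32
    simp only [map_sub, map_mul, eval_coord]
    simp only [← e12, ← e34, ← e14, ← e32]
    ring

/-- Without `a`, `d` and `g`, the block of the left-hand side in rows `1, 2, 3` and columns
`4, 5, 6` factors through the last two columns of `u`, so it has rank at most two. -/
theorem obstructed_of_minor₁₂₃_₄₅₆ {P : Pattern} (hg : (2, 0) ∉ P) (hd : (1, 0) ∉ P)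
    (ha : (0, 0) ∉ P) (hb : (0, 1) ∈ P) (hc : (0, 2) ∈ P) (he : (1, 1) ∈ P)
    (hf : (1, 2) ∈ P) (hh : (2, 1) ∈ P) (hk : (2, 2) ∈ P) : Obstructed P := by
  -- the minor, expanded along its first row, whose last entry is zero
  refine .of_point (coord P 1 0 1 * (coord P 2 0 1 * coord P 1 1 2 *
    (coord P 3 0 2 * coord P 2 2 2) - coord P 2 0 2 *
    (coord P 3 0 1 * coord P 1 2 2 + coord P 3 0 2 * coord P 2 2 1 * coord P 1 1 2)) -
    coord P 1 0 2 * (coord P 2 0 1 * coord P 1 1 1 * (coord P 3 0 2 * coord P 2 2 2) -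
    coord P 2 0 2 * (coord P 3 0 1 * coord P 1 2 1 + coord P 3 0 2 * coord P 2 2 1 *
    coord P 1 1 1)))
    (fun k i j => if (k = 1 ∨ k = 2) ∧ (i, j) = (0, 2) then 0 else 1) ?_ fun X U H => ?_
  · simp [factor_point, hb, hc, he, hf, hh, hk]
  · have e14 := H.entry 0 3
    have e15 := H.entry 0 4
    have e16 := H.entry 0 5
    have e24 := H.entry 1 3
    have e25 := H.entry 1 4
    have e26 := H.entry 1 5
    have e34 := H.entry 2 3
    have e35 := H.entry 2 4
    have e36 := H.entry 2 5
    simp [ext_mul_left, ext_mul_right, factor_of_notMem _ _ hg, factor_of_notMem _ _ hd,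
      factor_of_notMem _ _ ha] at e14 e15 e16 e24 e25 e26 e34 e35 e36
    simp only [map_sub, map_mul, map_add, eval_coord]
    simp only [← e14, ← e15, ← e24, ← e25, ← e26, ← e34, ← e35, ← e36]
    -- the cofactor of the entry `(1, 6)`, which is zero on the right-hand side
    linear_combination -(factor P U 2 0 1 * factor P U 3 0 1 *
      (factor P U 0 1 1 * factor P U 0 2 2 - factor P U 0 1 2 * factor P U 0 2 1)) * e16

/-! ### Patterns with at least six positions -/

theorem card_eq_sum_ite (P : Pattern) : P.card = ∑ i, ∑ j, if (i, j) ∈ P then 1 else 0 := by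
  rw [← Fintype.sum_prod_type' (f := fun i j => if (i, j) ∈ P then 1 else 0)]
  simp

/-- Every pattern with at most three missing positions falls under one of the obstructions. -/
theorem obstructed_of_six_le_card (P : Pattern) (hc : 6 ≤ P.card) : Obstructed P := by
  rw [card_eq_sum_ite] at hc
  simp only [Fin.sum_univ_three] at hc
  by_cases hg : (2, 0) ∈ P
  · exact obstructed_of_corner_mem hg
  by_cases hd : (1, 0) ∈ P <;> by_cases hh : (2, 1) ∈ P
  · have h2 := @obstructed_of_path P hg hd hh
    have h3 := h2 (i := 2) (j := 0)
    have h4 := h2 (i := 2) (j := 1)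
    have h5 := h2 (i := 2) (j := 2)
    have h6 := h2 (i := 0) (j := 0)
    have h7 := h2 (i := 1) (j := 0)
    have := @obstructed_of_entry₃₂ P
    grind
  · have := @obstructed_of_minor₄₅_₃₅ P
    have := @obstructed_of_entry₄₃ P
    have := @obstructed_of_minor₄₅_₃₆ P
    have := @obstructed_of_minor₁₂₄_₃₅₆ P
    grind
  · have := @obstructed_of_minor₂₃_₂₄ P
    have := @obstructed_of_entry₃₄ P
    have := @obstructed_of_minor₁₃_₂₄ P
    have := @obstructed_of_minor₁₂₃_₄₅₆ P
    grind
  · have := @obstructed_of_minor₂₃_₃₅ P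
    grind

/-! ### Rational solutions for block patterns -/

section RationalSolution

variable {R : Type*} [CommRing R]

/-- The common denominator of the solution. For the `2 × 2` matrix `m` formed by the entries of
the right-hand side in rows `1, 2` and columns `2, 4`, it is the product
`(w₁, w₂) · adj m · (u₁, u₂)`, with `u₁, u₂` and `w₁, w₂` as in `solNumer`. -/
def solDenom (x y z : Matrix (Fin 3) (Fin 3) R) : R :=
  y 0 0 * x 0 0 * ((z 1 0 * x 1 1 + z 1 1 * y 1 0 * x 0 1) * (z 0 1 * y 1 1) -
      z 1 1 * y 1 1 * (z 0 0 * x 1 1 + z 0 1 * y 1 0 * x 0 1)) +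
    (z 0 0 * x 1 0 + z 0 1 * y 1 0 * x 0 0) * (z 1 1 * y 1 1 * (y 0 0 * x 0 1) -
      (z 1 0 * x 1 1 + z 1 1 * y 1 0 * x 0 1) * y 0 1)

/-- Numerators over `solDenom` of a solution `(u, v, w, r)`. The solution is not unique,
which is used to set `a` and `e` of `v`, `f` and `k` of `u` and `v`, and `k` of `w`, to `1`. Here `u₁, u₂`
is the first column of `u`, `w₁, w₂` is the second row of `w`, and `mᵢⱼ` are the entries of the
right-hand side in rows `1, 2` and columns `2, 4`. The same formulas serve the patterns with `f`
and those with `k`, since the terms of `r` that contain an absent entry vanish. -/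
def solNumer (x y z t : Matrix (Fin 3) (Fin 3) R) : Fin 4 → Matrix (Fin 3) (Fin 3) R :=
  let q := solDenom x y z
  let m₁₁ := y 0 0 * x 0 1
  let m₁₂ := y 0 1
  let m₂₁ := z 0 0 * x 1 1 + z 0 1 * y 1 0 * x 0 1
  let m₂₂ := z 0 1 * y 1 1
  let u₁ := y 0 0 * x 0 0
  let u₂ := z 0 0 * x 1 0 + z 0 1 * y 1 0 * x 0 0
  let w₁ := z 1 0 * x 1 1 + z 1 1 * y 1 0 * x 0 1
  let w₂ := z 1 1 * y 1 1
  ![q • !![u₁, w₂ * m₁₁ - w₁ * m₁₂, 0; u₂, w₂ * m₂₁ - w₁ * m₂₂, 1; 0, 0, 1],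
    !![q, m₁₁ * m₂₂ - m₁₂ * m₂₁, 0; q * (z 1 0 * x 1 0 + z 1 1 * y 1 0 * x 0 0), q, q; 0, 0, q],
    !![u₂ * m₁₁ - u₁ * m₂₁, u₂ * m₁₂ - u₁ * m₂₂, 0; q * w₁, q * w₂, 0; 0, 0, q],
    q • !![t 0 0 * x 2 2 + z 0 0 * x 1 2, t 0 1 * y 2 2 + z 0 1 * y 1 2, 0;
      t 1 0 * x 2 2 + z 1 0 * x 1 2, t 1 1 * y 2 2 + z 1 1 * y 1 2, z 1 2;
      0, 0, t 2 2 * z 2 2]]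

variable {S : Type*} [CommRing S]

theorem map_solDenom (φ : R →+* S) (x y z : Matrix (Fin 3) (Fin 3) R) :
    φ (solDenom x y z) = solDenom (x.map φ) (y.map φ) (z.map φ) := by
  simp [solDenom]

theorem map_solNumer (φ : R →+* S) (x y z t : Matrix (Fin 3) (Fin 3) R) (k : Fin 4)
  (i j : Fin 3) :
    φ (solNumer x y z t k i j) =
      solNumer (x.map φ) (y.map φ) (z.map φ) (t.map φ) k i j := by
  fin_cases k <;> fin_cases i <;> fin_cases j <;> simp [solNumer, map_solDenom]

end RationalSolution

theorem map_eval_coord (P : Pattern) (X : PhaseSpace P) (k : Fin 4) :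
    (coord P k).map (MvPolynomial.eval X) = factor P X k := by
  ext i j
  simp

/-- The local tetrahedron equation entry by entry, for patterns without `c`, `g` and `h`. The
hypothesis `e26` is a choice of solution rather than an equation: `f` of `w` may be taken to be
zero, and then the entry `(2, 6)` vanishes on both sides. -/
theorem LocalTetrahedron.of_block {P : Pattern} {X U : PhaseSpace P}
    (hc : (0, 2) ∉ P) (hg : (2, 0) ∉ P) (hh : (2, 1) ∉ P)
    {u v w r x y z t : Matrix (Fin 3) (Fin 3) ℂ}
    (hu : factor P U 0 = u) (hv : factor P U 1 = v) (hw : factor P U 2 = w)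
    (hr : factor P U 3 = r) (hx : factor P X 0 = x) (hy : factor P X 1 = y)
    (hz : factor P X 2 = z) (ht : factor P X 3 = t)
    (e11 : u 0 0 * v 0 0 = y 0 0 * x 0 0)
    (e12 : u 0 0 * v 0 1 * w 1 0 + u 0 1 * w 0 0 = y 0 0 * x 0 1)
    (e14 : u 0 0 * v 0 1 * w 1 1 + u 0 1 * w 0 1 = y 0 1)
    (e21 : u 1 0 * v 0 0 = z 0 0 * x 1 0 + z 0 1 * y 1 0 * x 0 0)
    (e22 : u 1 0 * v 0 1 * w 1 0 + u 1 1 * w 0 0 = z 0 0 * x 1 1 + z 0 1 * y 1 0 * x 0 1)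
    (e24 : u 1 0 * v 0 1 * w 1 1 + u 1 1 * w 0 1 = z 0 1 * y 1 1)
    (e41 : v 1 0 = z 1 0 * x 1 0 + z 1 1 * y 1 0 * x 0 0)
    (e42 : v 1 1 * w 1 0 = z 1 0 * x 1 1 + z 1 1 * y 1 0 * x 0 1)
    (e44 : v 1 1 * w 1 1 = z 1 1 * y 1 1)
    (e23 : u 1 2 * r 0 0 = z 0 0 * x 1 2) (e25 : u 1 2 * r 0 1 = z 0 1 * y 1 2)
    (e43 : v 1 2 * r 1 0 = z 1 0 * x 1 2) (e45 : v 1 2 * r 1 1 = z 1 1 * y 1 2)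
    (e33 : u 2 2 * r 0 0 = t 0 0 * x 2 2) (e35 : u 2 2 * r 0 1 = t 0 1 * y 2 2)
    (e53 : v 2 2 * r 1 0 = t 1 0 * x 2 2) (e55 : v 2 2 * r 1 1 = t 1 1 * y 2 2)
    (e26 : w 1 2 = 0) (e46 : v 1 2 * r 1 2 = z 1 2) (e56 : v 2 2 * r 1 2 = t 1 2 * z 2 2)
    (e66 : w 2 2 * r 2 2 = t 2 2 * z 2 2) :
    LocalTetrahedron P X U := by
  have h0 (Y : PhaseSpace P) (k : Fin 4) :
      factor P Y k 0 2 = 0 ∧ factor P Y k 2 0 = 0 ∧ factor P Y k 2 1 = 0 :=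
    ⟨factor_of_notMem Y k hc, factor_of_notMem Y k hg, factor_of_notMem Y k hh⟩
  obtain ⟨hu1, hu2, hu3⟩ := hu ▸ h0 U 0
  obtain ⟨hv1, hv2, hv3⟩ := hv ▸ h0 U 1
  obtain ⟨hw1, hw2, hw3⟩ := hw ▸ h0 U 2
  obtain ⟨hr1, hr2, hr3⟩ := hr ▸ h0 U 3
  obtain ⟨hx1, hx2, hx3⟩ := hx ▸ h0 X 0
  obtain ⟨hy1, hy2, hy3⟩ := hy ▸ h0 X 1
  obtain ⟨hz1, hz2, hz3⟩ := hz ▸ h0 X 2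
  obtain ⟨ht1, ht2, ht3⟩ := ht ▸ h0 X 3
  rw [LocalTetrahedron, ext_mul_left, ext_mul_right, hu, hv, hw, hr, hx, hy, hz, ht]
  simp only [mul_zero, zero_mul, add_zero, zero_add, *]

/-- Completing the first column `(u₁, u₂)` and the first row `(w₁, w₂)` to a decomposition
`m = s • (u₁, u₂)ᵀ (w₁, w₂) + p ⬝ r` into rank-one matrices: `s` is the value `det m / q` for which
the difference `m - s • (u₁, u₂)ᵀ (w₁, w₂)` becomes singular, and `p`, `r` factor this difference. -/
theorem rank_one_completion {K : Type*} [Field K] {q : K} (hq : q ≠ 0)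
    (u₁ u₂ w₁ w₂ m₁₁ m₁₂ m₂₁ m₂₂ : K)
    (h : q = u₁ * (w₁ * m₂₂ - w₂ * m₂₁) + u₂ * (w₂ * m₁₁ - w₁ * m₁₂)) :
    (u₁ * ((m₁₁ * m₂₂ - m₁₂ * m₂₁) / q) * w₁ +
      (w₂ * m₁₁ - w₁ * m₁₂) * ((u₂ * m₁₁ - u₁ * m₂₁) / q) = m₁₁) ∧
    (u₁ * ((m₁₁ * m₂₂ - m₁₂ * m₂₁) / q) * w₂ +
      (w₂ * m₁₁ - w₁ * m₁₂) * ((u₂ * m₁₂ - u₁ * m₂₂) / q) = m₁₂) ∧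
    (u₂ * ((m₁₁ * m₂₂ - m₁₂ * m₂₁) / q) * w₁ +
      (w₂ * m₂₁ - w₁ * m₂₂) * ((u₂ * m₁₁ - u₁ * m₂₁) / q) = m₂₁) ∧
    (u₂ * ((m₁₁ * m₂₂ - m₁₂ * m₂₁) / q) * w₂ +
      (w₂ * m₂₁ - w₁ * m₂₂) * ((u₂ * m₁₂ - u₁ * m₂₂) / q) = m₂₂) := by
  refine ⟨?_, ?_, ?_, ?_⟩ <;> field_simp <;> rw [h] <;> ring

/-- The quotients of `solNumer` by `solDenom`, restricted to the positions of the pattern, solve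
the local tetrahedron equation. -/
theorem localTetrahedron_solNumer_div_solDenom {P : Pattern} (ha : (0, 0) ∈ P) (hb : (0, 1) ∈ P)
    (hd : (1, 0) ∈ P) (he : (1, 1) ∈ P) (hc : (0, 2) ∉ P) (hg : (2, 0) ∉ P) (hh : (2, 1) ∉ P)
    (hfk : (1, 2) ∉ P ∨ (2, 2) ∉ P) (X : PhaseSpace P)
    (hq : solDenom (factor P X 0) (factor P X 1) (factor P X 2) ≠ 0) :
    LocalTetrahedron P X (point P fun k i j =>
      solNumer (factor P X 0) (factor P X 1) (factor P X 2) (factor P X 3) k i j /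
        solDenom (factor P X 0) (factor P X 1) (factor P X 2)) := by
  have hf0 (h : (1, 2) ∉ P) (k : Fin 4) : factor P X k 1 2 = 0 := factor_of_notMem X k h
  have hk0 (h : (2, 2) ∉ P) (k : Fin 4) : factor P X k 2 2 = 0 := factor_of_notMem X k h
  obtain ⟨h₁₁, h₁₂, h₂₁, h₂₂⟩ := rank_one_completion hq _ _ _ _ _ _ _ _ rfl
  apply LocalTetrahedron.of_block hc hg hh rfl rfl rfl rfl rfl rfl rfl rfl
  all_goals
    simp only [factor_point, ha, hb, hd, he, if_true, solNumer]
    generalize solDenom (factor P X 0) (factor P X 1) (factor P X 2) = q at hq h₁₁ h₁₂ h₂₁ h₂₂ ⊢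
    simp [hq]
  case e12 => exact h₁₁
  case e14 => exact h₁₂
  case e22 => exact h₂₁
  case e24 => exact h₂₂
  all_goals
    clear h₁₁ h₁₂ h₂₁ h₂₂
    by_cases hf : (1, 2) ∈ P <;> by_cases hk : (2, 2) ∈ P <;> simp_all

/-- A pattern made of the upper left `2 × 2` block and at most one of the positions `f` and `k`
generates a rational map with denominator `solDenom`. -/
theorem generatesRationalMap_of_block {P : Pattern} (ha : (0, 0) ∈ P) (hb : (0, 1) ∈ P)
    (hd : (1, 0) ∈ P) (he : (1, 1) ∈ P) (hc : (0, 2) ∉ P) (hg : (2, 0) ∉ P) (hh : (2, 1) ∉ P)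
    (hfk : (1, 2) ∉ P ∨ (2, 2) ∉ P) : GeneratesRationalMap P := by
  have hq (X : PhaseSpace P) :
      MvPolynomial.eval X (solDenom (coord P 0) (coord P 1) (coord P 2)) =
      solDenom (factor P X 0) (factor P X 1) (factor P X 2) := by
    simp [map_solDenom, map_eval_coord]
  have hq0 : solDenom (coord P 0) (coord P 1) (coord P 2) ≠ 0 := by
    intro h0
    -- `solDenom` takes the value `1` at this point
    have := hq (point P fun k i j => if k = 0 ∧ i = 0 ∧ j = 0 ∨ k = 2 ∧ i = 1 ∧ j = 0 then 2
      else if k = 1 ∧ i = 1 ∧ j = 0 then 0 else 1)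
    rw [h0] at this
    simp [solDenom, factor_point, ha, hb, hd, he] at this
    norm_num at this
  refine ⟨solDenom (coord P 0) (coord P 1) (coord P 2), fun p =>
    solNumer (coord P 0) (coord P 1) (coord P 2) (coord P 3) p.1 p.2.1.1 p.2.1.2, hq0, ?_, ?_⟩
  · intro f hf
    -- `f * q` vanishes everywhere, and polynomials over `ℂ` are determined by their values
    by_contra hf0
    refine mul_ne_zero hf0 hq0 (MvPolynomial.funext fun X => ?_)
    by_cases hX : MvPolynomial.eval X (solDenom (coord P 0) (coord P 1) (coord P 2)) = 0
    · simp [hX]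
    · simp [hf X hX]
  · intro X hX
    simp only [Set.mem_ofPred_eq, hq] at hX
    simp only [map_solNumer, map_eval_coord, hq]
    exact localTetrahedron_solNumer_div_solDenom ha hb hd he hc hg hh hfk X hX

/-! ### The maximum dimension -/

theorem mapDim_eq (P : Pattern) : mapDim P = 4 * P.card := by
  simp [mapDim]

theorem patternA_generatesRationalMap : GeneratesRationalMap patternA :=
  generatesRationalMap_of_block (by decide) (by decide) (by decide) (by decide) (by decide)
    (by decide) (by decide) (.inl (by decide))

theorem patternB_generatesRationalMap : GeneratesRationalMap patternB :=
  generatesRationalMap_of_block (by decide) (by decide) (by decide) (by decide) (by decide)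
    (by decide) (by decide) (.inr (by decide))

theorem corollary3p2 :
    IsGreatest {n : ℕ | ∃ (P : Pattern) (D : Set (PhaseSpace P)) (S : PhaseSpace P → PhaseSpace P),
      GeneratesMap P D S ∧ mapDim P = n} 20 ∧
    (patternA.card = 5 ∧ mapDim patternA = 20 ∧ GeneratesRationalMap patternA) ∧
    (patternB.card = 5 ∧ mapDim patternB = 20 ∧ GeneratesRationalMap patternB) := by
  have hA : patternA.card = 5 := by decide
  have hB : patternB.card = 5 := by decide
  have hA' : mapDim patternA = 20 := by rw [mapDim_eq, hA]
  have hB' : mapDim patternB = 20 := by rw [mapDim_eq, hB]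
  refine ⟨⟨?_, ?_⟩, ⟨hA, hA', patternA_generatesRationalMap⟩,
    ⟨hB, hB', patternB_generatesRationalMap⟩⟩
  · obtain ⟨q, N, -, h⟩ := patternA_generatesRationalMap
    exact ⟨patternA, _, _, h, hA'⟩
  · rintro n ⟨P, D, S, h, rfl⟩
    by_contra! hn
    rw [mapDim_eq] at hn
    exact (obstructed_of_six_le_card P (by omega)).not_generatesMap D S h
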